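/- Let $m,k\ge 0$ be integers, let $f\colon(\mathbb{R}^m\times\mathbb{R}^k,(x_0,y_0))\to(\mathbb{R}^k,z_0)$ be a germ of a Lipschitz map (so $f$ is Lipschitz on a neighbourhood of $(x_0,y_0)$ and $f(x_0,y_0)=z_0$). Let $\partial f(x_0,y_0)$ be Clarke's generalized differential, that is, the convex hull of the set of all limits $\lim_{\nu} df(p_\nu)$, where $(p_\nu)$ is a sequence of points of differentiability of $f$ with $p_\nu\to(x_0,y_0)$ for which the limit exists. Assume that every $\ell\in\partial f(x_0,y_0)$ satisfies $$\operatorname{Ker}\ell\cap(\{0\}^m\times\mathbb{R}^k)=\{0\}.$$ Then there is a germ of a bilipschitz homeomorphism $$\varphi\colon(\mathbb{R}^m\times\mathbb{R}^k,(x_0,y_0))\to(\mathbb{R}^m\times\mathbb{R}^k,(0,z_0))$$ such that $f=\pi\circ\varphi$ near $(x_0,y_0)$, where $\pi\colon\mathbb{R}^m\times\mathbb{R}^k\to\mathbb{R}^k$ is the natural projection; that is, there is a homeomorphism $\varphi$ from an open neighbourhood of $(x_0,y_0)$ onto an open neighbourhood of $(0,z_0)$, with $\varphi$ and $\varphi^{-1}$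 Lipschitz and $\varphi(x_0,y_0)=(0,z_0)$, such that $f=\pi\circ\varphi$ on that neighbourhood. In other words, $f$ is bilipschitz equivalent to a linear projection. -/

import Mathlib

open Filter Topology
open scoped NNReal

/-- The germ of `f` at `p` is Lipschitz: `f` is Lipschitz on some neighbourhood of `p`. -/
def IsLipschitzGermAt {E F : Type*} [PseudoEMetricSpace E] [PseudoEMetricSpace F]
    (f : E → F) (p : E) : Prop :=
  ∃ K : ℝ≥0, ∃ s ∈ 𝓝 p, LipschitzOnWith K f s

/-- All possible limits of the differentials of `f` along sequences of differentiability points of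
`f` that converge to `p`. -/
def limitingDifferentials {E F : Type*} [NormedAddCommGroup E] [NormedSpace ℝ E]
    [NormedAddCommGroup F] [NormedSpace ℝ F] (f : E → F) (p : E) : Set (E →L[ℝ] F) :=
  {A | ∃ u : ℕ → E, Tendsto u atTop (𝓝 p) ∧ (∀ i, DifferentiableAt ℝ f (u i)) ∧
    Tendsto (fun i => fderiv ℝ f (u i)) atTop (𝓝 A)}

/-- Clarke's generalized differential `∂f(p)`: the convex hull of the set of all limits of
differentials of `f` at points tending to `p`. -/
def clarkeDifferential {E F : Type*} [NormedAddCommGroup E] [NormedSpace ℝ E]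
    [NormedAddCommGroup F] [NormedSpace ℝ F] (f : E → F) (p : E) : Set (E →L[ℝ] F) :=
  convexHull ℝ (limitingDifferentials f p)

/-- A homeomorphism between an open subset of `E` and an open subset of `F` is bilipschitz if both
it and its inverse are Lipschitz. -/
def IsBilipschitzHomeomorph {E F : Type*} [PseudoEMetricSpace E] [PseudoEMetricSpace F]
    (φ : OpenPartialHomeomorph E F) : Prop :=
  (∃ K : ℝ≥0, LipschitzOnWith K φ φ.source) ∧ ∃ K : ℝ≥0, LipschitzOnWith K φ.symm φ.target

open MeasureTheory Set Metric

/-! The map `Φ (x, y) = (x - x₀, f (x, y))` has `f` as its second component, so it suffices that `Φ`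
is bilipschitz onto an open set near the base point. Restricting `∂f` to `{0} × F` gives a compact
convex set `T` of invertible endomorphisms. For each `v`, separating `{A v | A ∈ T}` from the origin
yields a vector `w` of norm at most 1 with `⟪w, A v⟫ ≥ c ‖v‖` on `T`. Differentials at points near
`p` are close to limiting ones, so the bound survives there with a smaller constant. Integration
along lines turns it into `c ‖y' - y‖ ≤ ‖f (x, y') - f (x, y)‖`, which makes `Φ` injective with
Lipschitz inverse. Openness uses the same separation for the adjoints of `T`: every functional `⟪u,
f⟫` grows along some direction of `F`, so a nonzero value of `‖f (x, ·) - z‖` cannot be a local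
minimum, and minimizing over a small ball solves `f (x, y) = z`. -/

/-- In finite dimension, the convex hull of a compact set is compact. -/
theorem IsCompact.convexHull_of_finiteDimensional {V : Type*} [NormedAddCommGroup V]
    [NormedSpace ℝ V] [FiniteDimensional ℝ V] {s : Set V} (hs : IsCompact s) :
    IsCompact (convexHull ℝ s) := by
  rcases s.eq_empty_or_nonempty with rfl | ⟨z₀, hz₀⟩
  · simp
  let N := Module.finrank ℝ V + 1
  -- Carathéodory: at most `N` points suffice; shorter combinations are padded with copies of `z₀`
  -- of weight zero.
  have hcomb : convexHull ℝ s = (fun q : (Fin N → ℝ) × (Fin N → V) => ∑ j, q.1 j • q.2 j) ''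
      (stdSimplex ℝ (Fin N) ×ˢ univ.pi fun _ => s) := by
    refine Subset.antisymm (fun x hx => ?_) ?_
    · obtain ⟨ι, _, z, w, hz, hind, hw, hw1, rfl⟩ := eq_pos_convex_span_of_mem_convexHull hx
      have hcard : Fintype.card ι ≤ Fintype.card (Fin N) := by
        rw [Fintype.card_fin]
        exact hind.card_le_finrank_succ.trans (Nat.succ_le_succ (Submodule.finrank_le _))
      obtain ⟨e⟩ := Function.Embedding.nonempty_of_card_le hcard
      have hout : ∀ j ∉ range e, Function.extend e w 0 j = 0 := fun j hj =>
        Function.extend_apply' _ _ _ hj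
      refine ⟨(Function.extend e w 0, Function.extend e z fun _ => z₀), ⟨⟨fun j => ?_, ?_⟩,
        fun j _ => ?_⟩, ?_⟩
      · by_cases hj : j ∈ range e
        · obtain ⟨i, rfl⟩ := hj
          simpa [e.injective.extend_apply] using (hw i).le
        · exact (hout j hj).ge
      · rw [← hw1]
        exact (Fintype.sum_of_injective e e.injective _ _ hout
          fun i => by rw [e.injective.extend_apply]).symm
      · by_cases hj : j ∈ range e
        · obtain ⟨i, rfl⟩ := hj
          simpa [e.injective.extend_apply] using hz ⟨i, rfl⟩
        · simpa [Function.extend_apply' _ _ _ hj] using hz₀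
      · refine (Fintype.sum_of_injective e e.injective _ _ (fun j hj => ?_) fun i => ?_).symm
        · simp [hout j hj]
        · simp [e.injective.extend_apply]
    · rintro _ ⟨⟨w, z⟩, ⟨⟨hw0, hw1⟩, hz⟩, rfl⟩
      exact (convex_convexHull ℝ s).sum_mem (fun j _ => hw0 j) hw1
        fun j _ => subset_convexHull ℝ s (hz j (mem_univ j))
  rw [hcomb]
  exact ((isCompact_stdSimplex ℝ _).prod (isCompact_univ_pi fun _ => hs)).image (by fun_prop)

/-! ### Compactness and semicontinuity of the Clarke differential -/

section LimitingDifferentials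

variable {E G : Type*} [NormedAddCommGroup E] [NormedSpace ℝ E]
  [NormedAddCommGroup G] [NormedSpace ℝ G]

/-- The limits form the fibre over `p` of the closure of the graph of the differential. -/
theorem isClosed_limitingDifferentials (f : E → G) (p : E) :
    IsClosed (limitingDifferentials f p) := by
  have : limitingDifferentials f p = (fun A : E →L[ℝ] G => (p, A)) ⁻¹'
      closure ((fun x => (x, fderiv ℝ f x)) '' {x | DifferentiableAt ℝ f x}) := by
    ext A
    rw [mem_preimage, mem_closure_iff_seq_limit]
    constructor
    · rintro ⟨u, hu, hd, hA⟩
      exact ⟨fun i => (u i, fderiv ℝ f (u i)), fun i => ⟨u i, hd i, rfl⟩, hu.prodMk_nhds hA⟩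
    · rintro ⟨x, hx, hlim⟩
      choose u hd hux using hx
      obtain rfl : (fun i => (u i, fderiv ℝ f (u i))) = x := funext hux
      exact ⟨u, hlim.fst_nhds, hd, hlim.snd_nhds⟩
  rw [this]
  exact isClosed_closure.preimage (by fun_prop)

theorem LipschitzOnWith.norm_le_of_mem_limitingDifferentials {f : E → G} {p : E} {K : ℝ≥0}
    {s : Set E} (hf : LipschitzOnWith K f s) (hs : s ∈ 𝓝 p) {A : E →L[ℝ] G}
    (hA : A ∈ limitingDifferentials f p) : ‖A‖ ≤ K := by
  obtain ⟨u, hu, -, hlim⟩ := hA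
  refine le_of_tendsto hlim.norm ?_
  filter_upwards [hu.eventually (eventually_mem_nhds_iff.2 hs)] with i hi
  exact norm_fderiv_le_of_lipschitzOn ℝ hi hf

variable [FiniteDimensional ℝ E] [FiniteDimensional ℝ G]

theorem LipschitzOnWith.isCompact_clarkeDifferential {f : E → G} {p : E} {K : ℝ≥0}
    {s : Set E} (hf : LipschitzOnWith K f s) (hs : s ∈ 𝓝 p) :
    IsCompact (clarkeDifferential f p) := by
  refine IsCompact.convexHull_of_finiteDimensional (isCompact_of_isClosed_isBounded
    (isClosed_limitingDifferentials f p) ?_)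
  refine isBounded_closedBall (x := 0) (r := (K : ℝ)) |>.subset fun A hA => ?_
  simpa using hf.norm_le_of_mem_limitingDifferentials hs hA

/-- The differentials of a Lipschitz map near `p` are close to limiting differentials at `p`. -/
theorem LipschitzOnWith.eventually_exists_limitingDifferentials_norm_sub_lt {f : E → G} {p : E}
    {K : ℝ≥0} {s : Set E} (hf : LipschitzOnWith K f s) (hs : s ∈ 𝓝 p) {ε : ℝ} (hε : 0 < ε) :
    ∀ᶠ x in 𝓝 p, DifferentiableAt ℝ f x →
      ∃ A ∈ limitingDifferentials f p, ‖fderiv ℝ f x - A‖ < ε := by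
  by_contra hcon
  rw [not_eventually] at hcon
  obtain ⟨u, hu, hprop⟩ := exists_seq_forall_of_frequently
    (hcon.and_eventually (eventually_mem_nhds_iff.2 hs))
  simp only [Classical.not_imp, not_exists, not_and, not_lt] at hprop
  obtain ⟨A, -, φ, hφ, hlim⟩ := tendsto_subseq_of_bounded
    (isBounded_closedBall (x := (0 : E →L[ℝ] G)) (r := (K : ℝ)))
    (x := fun i => fderiv ℝ f (u i)) fun i => by
      simpa using norm_fderiv_le_of_lipschitzOn ℝ (hprop i).2 hf
  have hA : A ∈ limitingDifferentials f p :=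
    ⟨u ∘ φ, hu.comp hφ.tendsto_atTop, fun i => (hprop (φ i)).1.1, hlim⟩
  have h0 : Tendsto (fun i => ‖fderiv ℝ f (u (φ i)) - A‖) atTop (𝓝 0) := by
    simpa using (hlim.sub_const A).norm
  exact hε.not_ge (ge_of_tendsto' h0 fun i => (hprop (φ i)).1.2 A hA)

end LimitingDifferentials

/-! ### Openness by minimization -/

/-- If every linear functional `inner u` of a Lipschitz map `g` increases at a definite rate in some
direction, then a local minimum of `‖g - z‖` is a solution of `g y = z`. -/
theorem eq_of_isLocalMin_norm_sub {F : Type*} [NormedAddCommGroup F] [InnerProductSpace ℝ F]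
    {g : F → F} {z y : F} {K : ℝ≥0} {V : Set F} {c : ℝ}
    (hc : 0 < c) (hV : V ∈ 𝓝 y) (hg : LipschitzOnWith K g V)
    (hdir : ∀ u : F, ∃ v : F, ∀ a, ∀ t ≥ (0 : ℝ), a ∈ V → a + t • v ∈ V →
      t * (c * ‖u‖) ≤ inner ℝ u (g (a + t • v) - g a))
    (hmin : IsLocalMin (fun a => ‖g a - z‖) y) : g y = z := by
  by_contra hne
  have hu : 0 < ‖g y - z‖ := norm_pos_iff.2 (sub_ne_zero.2 hne)
  obtain ⟨v, hv⟩ := hdir (g y - z)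
  have hlim : Tendsto (fun t : ℝ => y - t • v) (𝓝[>] 0) (𝓝 y) := by
    have : Tendsto (fun t : ℝ => y - t • v) (𝓝 0) (𝓝 (y - (0 : ℝ) • v)) :=
      Continuous.tendsto (by fun_prop) 0
    rw [zero_smul, sub_zero] at this
    exact this.mono_left nhdsWithin_le_nhds
  -- With `u = g y - z`, moving to `y - t • v` lowers `‖g - z‖ ^ 2` by at least `2 * t * c * ‖u‖`,
  -- up to an error of at most `t ^ 2 * (K * ‖v‖) ^ 2`; for small `t` the gain wins.
  have hsmall : ∀ᶠ t : ℝ in 𝓝[>] 0, t * (K * ‖v‖) ^ 2 < 2 * (c * ‖g y - z‖) := by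
    have : Tendsto (fun t : ℝ => t * (K * ‖v‖) ^ 2) (𝓝 0) (𝓝 (0 * (K * ‖v‖) ^ 2)) :=
      Continuous.tendsto (by fun_prop) 0
    rw [zero_mul] at this
    exact (this.mono_left nhdsWithin_le_nhds).eventually_lt_const (by positivity)
  obtain ⟨t, ⟨⟨hmt, hVt⟩, ht⟩, ht0⟩ := (((hlim.eventually hmin).and
    (hlim.eventually hV)).and hsmall |>.and self_mem_nhdsWithin).exists
  replace ht0 : 0 < t := ht0
  have hy := mem_of_mem_nhds hV
  have h1 := hv (y - t • v) t ht0.le hVt (by simpa using hy)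
  rw [sub_add_cancel] at h1
  have h2 : ‖g (y - t • v) - g y‖ ≤ K * (t * ‖v‖) := by
    refine (hg.norm_sub_le hVt hy).trans_eq ?_
    rw [sub_sub_cancel_left, norm_neg, norm_smul, Real.norm_of_nonneg ht0.le]
  have h3 : ‖g (y - t • v) - z‖ ^ 2 = ‖g y - z‖ ^ 2
      - 2 * inner ℝ (g y - z) (g y - g (y - t • v)) + ‖g (y - t • v) - g y‖ ^ 2 := by
    have : g (y - t • v) - z = (g y - z) - (g y - g (y - t • v)) := by abel
    rw [this, norm_sub_sq_real, norm_sub_rev (g y) (g (y - t • v))]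
  have h4 : ‖g y - z‖ ^ 2 ≤ ‖g (y - t • v) - z‖ ^ 2 := by gcongr
  have h5 : ‖g (y - t • v) - g y‖ ^ 2 ≤ (K * (t * ‖v‖)) ^ 2 := by gcongr
  have h6 := mul_lt_mul_of_pos_left ht ht0
  nlinarith

section ClarkeInverse

variable {E F : Type*} [NormedAddCommGroup E] [NormedAddCommGroup F] [InnerProductSpace ℝ F]
  [FiniteDimensional ℝ F]

/-- Openness of `(x, y) ↦ (x - x₀, f (x, y))`, by minimizing `‖f (x, ·) - z‖`. -/
theorem isOpen_image_prodMk_sub {f : E × F → F} {K : ℝ≥0} {c : ℝ} (hc : 0 < c)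
    {U : Set (E × F)} (hU : IsOpen U) (hK : LipschitzOnWith K f U) (x₀ : E)
    (hbound : ∀ x y y', (x, y) ∈ U → (x, y') ∈ U → c * ‖y' - y‖ ≤ ‖f (x, y') - f (x, y)‖)
    (hdir : ∀ u : F, ∃ v : F, ∀ x y, ∀ t ≥ (0 : ℝ), (x, y) ∈ U → (x, y + t • v) ∈ U →
        t * (c * ‖u‖) ≤ inner ℝ u (f (x, y + t • v) - f (x, y))) :
    IsOpen ((fun p : E × F => (p.1 - x₀, f p)) '' U) := by
  rw [isOpen_iff_mem_nhds]
  rintro _ ⟨⟨x₁, y₁⟩, h₁, rfl⟩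
  obtain ⟨ε, hε, hεU⟩ := Metric.isOpen_iff.1 hU _ h₁
  set r := ε / 2 with hr
  have hr0 : 0 < r := half_pos hε
  have hmem : ∀ x ∈ ball x₁ r, ∀ y ∈ closedBall y₁ r, (x, y) ∈ U := by
    intro x hx y hy
    refine hεU ?_
    rw [mem_ball, Prod.dist_eq, max_lt_iff]
    exact ⟨(mem_ball.1 hx).trans (half_lt_self hε),
      (mem_closedBall.1 hy).trans_lt (half_lt_self hε)⟩
  -- Expansion by `c` forces a minimizer `y` to satisfy `c * ‖y - y₁‖ ≤ 2 * ‖f (x, y₁) - z‖`; the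
  -- threshold `c * r / 2` thus keeps it inside the open ball.
  have hnear : ∀ᶠ q : E × F in 𝓝 (x₁ - x₀, f (x₁, y₁)), q.1 + x₀ ∈ ball x₁ r ∧
      K * ‖q.1 + x₀ - x₁‖ + ‖f (x₁, y₁) - q.2‖ < c * r / 2 := by
    refine Filter.Eventually.and ?_ ?_
    · have : Tendsto (fun q : E × F => q.1 + x₀) (𝓝 (x₁ - x₀, f (x₁, y₁)))
          (𝓝 (x₁ - x₀ + x₀)) := Continuous.tendsto (by fun_prop) (x₁ - x₀, f (x₁, y₁))
      rw [sub_add_cancel] at this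
      exact this.eventually (ball_mem_nhds _ hr0)
    · have : Tendsto (fun q : E × F => K * ‖q.1 + x₀ - x₁‖ + ‖f (x₁, y₁) - q.2‖)
          (𝓝 (x₁ - x₀, f (x₁, y₁))) (𝓝 (K * ‖x₁ - x₀ + x₀ - x₁‖ + ‖f (x₁, y₁) - f (x₁, y₁)‖)) :=
        Continuous.tendsto (by fun_prop) (x₁ - x₀, f (x₁, y₁))
      refine this.eventually_lt_const ?_
      simpa using by positivity
  filter_upwards [hnear] with ⟨a, z⟩ ⟨hx, hsmall⟩
  dsimp only at hx hsmall
  set x := a + x₀ with hxa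
  have hxU := hmem x hx
  have hy₁ : y₁ ∈ closedBall y₁ r := mem_closedBall_self hr0.le
  have hgK : LipschitzOnWith K (fun y => f (x, y)) (closedBall y₁ r) := by
    refine LipschitzOnWith.of_dist_le_mul fun y hy y' hy' => ?_
    refine (hK.dist_le_mul _ (hxU y hy) _ (hxU y' hy')).trans_eq ?_
    simp [Prod.dist_eq]
  obtain ⟨y, hy, hymin⟩ := (isCompact_closedBall y₁ r).exists_isMinOn ⟨y₁, hy₁⟩
    (f := fun y => ‖f (x, y) - z‖) ((hgK.continuousOn.sub continuousOn_const).norm)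
  have hcenter : ‖f (x, y₁) - z‖ < c * r / 2 := by
    refine lt_of_le_of_lt ?_ hsmall
    have h2 : ‖f (x, y₁) - f (x₁, y₁)‖ ≤ K * ‖x - x₁‖ := by
      refine (hK.norm_sub_le (hxU y₁ hy₁) h₁).trans_eq ?_
      simp [Prod.norm_def]
    have h3 := norm_sub_le_norm_sub_add_norm_sub (f (x, y₁)) (f (x₁, y₁)) z
    linarith
  have hyb : y ∈ ball y₁ r := by
    rw [mem_ball, dist_eq_norm]
    have h2 : ‖f (x, y) - z‖ ≤ ‖f (x, y₁) - z‖ := hymin hy₁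
    have h3 := hbound x y₁ y (hxU y₁ hy₁) (hxU y hy)
    have h4 := norm_sub_le_norm_sub_add_norm_sub (f (x, y)) z (f (x, y₁))
    rw [norm_sub_rev z] at h4
    exact lt_of_mul_lt_mul_left (by linarith) hc.le
  have hnhds : closedBall y₁ r ∈ 𝓝 y :=
    mem_of_superset (isOpen_ball.mem_nhds hyb) ball_subset_closedBall
  refine ⟨(x, y), hxU y hy, ?_⟩
  have hz : f (x, y) = z := eq_of_isLocalMin_norm_sub (g := fun y => f (x, y)) hc hnhds hgK
    (fun u => by
      obtain ⟨v, hv⟩ := hdir u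
      exact ⟨v, fun y t ht hy hy' => hv x y t ht (hxU _ hy) (hxU _ hy')⟩)
    (hymin.isLocalMin hnhds)
  change (x - x₀, f (x, y)) = (a, z)
  rw [hz, hxa, add_sub_cancel_right]

/-! ### Mean value inequality and uniform bounds -/

variable [NormedSpace ℝ E] [FiniteDimensional ℝ E]

/-- A mean value inequality for Lipschitz maps: a lower bound for the derivative in the direction
`v` at all points of differentiability gives the same bound for increments in direction `v`. -/
theorem LipschitzOnWith.le_inner_sub_of_forall_le_fderiv {f : E → F} {K : ℝ≥0} {U : Set E}
    (hf : LipschitzOnWith K f U) (hU : IsOpen U) (hc : Convex ℝ U) {w : F} {v : E} {a : ℝ}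
    (h : ∀ p ∈ U, DifferentiableAt ℝ f p → a ≤ inner ℝ w (fderiv ℝ f p v))
    {p : E} (hp : p ∈ U) (hpv : p + v ∈ U) : a ≤ inner ℝ w (f (p + v) - f p) := by
  borelize E
  let μ : Measure E := Measure.addHaar
  have hd : ∀ᵐ x ∂μ, x ∈ U → DifferentiableAt ℝ f x := by
    filter_upwards [hf.ae_differentiableWithinAt_of_mem (μ := μ)] with x hx hxU
    exact (hx hxU).differentiableAt (hU.mem_nhds hxU)
  obtain ⟨s, hs, hsm, hsd⟩ := hd.exists_measurable_mem
  -- Rademacher and Fubini: almost every line parallel to `v` meets the exceptional set in a null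
  -- set. Such lines are dense, so continuity covers the others.
  have hline : ∀ᵐ x ∂μ, ∀ᵐ t : ℝ, x + (LinearMap.toSpanSingleton ℝ E v) t ∈ s :=
    (ae_ae_add_linearMap_mem_iff _ volume μ hsm).2 hs
  have hgood : ∀ x ∈ U, x + v ∈ U → (∀ᵐ t : ℝ, x + (LinearMap.toSpanSingleton ℝ E v) t ∈ s) →
      a ≤ inner ℝ w (f (x + v) - f x) := by
    intro x hx hxv hxs
    have hseg : ∀ t ∈ Icc (0 : ℝ) 1, x + t • v ∈ U := fun t ht =>
      hc.add_smul_mem hx hxv ht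
    let g : ℝ → ℝ := fun t => inner ℝ w (f (x + t • v))
    have hg : LipschitzOnWith (‖w‖₊ * (K * ‖v‖₊)) g (uIcc 0 1) := by
      rw [uIcc_of_le zero_le_one]
      have h1 : LipschitzOnWith (K * ‖v‖₊) (fun t : ℝ => f (x + t • v)) (Icc 0 1) := by
        refine hf.comp (g := f) (f := fun t : ℝ => x + t • v) ?_ hseg
        refine LipschitzWith.lipschitzOnWith (LipschitzWith.of_dist_le_mul fun s t => ?_)
        rw [dist_add_left, dist_eq_norm, dist_eq_norm, ← sub_smul, norm_smul, mul_comm]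
        rfl
      have h2 : LipschitzWith ‖w‖₊ (fun y : F => inner ℝ w y) := by
        refine LipschitzWith.of_dist_le_mul fun y z => ?_
        rw [dist_eq_norm, dist_eq_norm, ← inner_sub_right]
        exact norm_inner_le_norm _ _
      exact h2.comp_lipschitzOnWith h1
    have hac := hg.absolutelyContinuousOnInterval
    have hI := hac.integral_deriv_eq_sub
    have hle : ∫ _ in (0 : ℝ)..1, a ≤ ∫ t in (0 : ℝ)..1, deriv g t := by
      refine intervalIntegral.integral_mono_ae_restrict zero_le_one (by simp)
        hac.intervalIntegrable_deriv ?_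
      refine (ae_restrict_iff' measurableSet_Icc).2 ?_
      filter_upwards [hxs] with t ht htI
      have htU := hseg t htI
      have hdt : DifferentiableAt ℝ f (x + t • v) := hsd _ ht htU
      have hder : HasDerivAt (fun t : ℝ => x + t • v) v t := by
        simpa using ((hasDerivAt_id t).smul_const v).const_add x
      have hcomp : HasDerivAt (fun t : ℝ => f (x + t • v)) (fderiv ℝ f (x + t • v) v) t :=
        hdt.hasFDerivAt.comp_hasDerivAt t hder
      have hgd : HasDerivAt g (inner ℝ w (fderiv ℝ f (x + t • v) v)) t :=
        ((innerSL ℝ w).hasFDerivAt).comp_hasDerivAt t hcomp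
      rw [hgd.deriv]
      exact h _ htU hdt
    rw [hI] at hle
    simpa [g, inner_sub_right] using hle
  by_contra! hlt
  have hcont : ContinuousOn f U := hf.continuousOn
  have h1 : ∀ᶠ x in 𝓝 p, x ∈ U := hU.mem_nhds hp
  have hadd : Tendsto (fun x : E => x + v) (𝓝 p) (𝓝 (p + v)) :=
    tendsto_id.add_const v
  have h2 : ∀ᶠ x in 𝓝 p, x + v ∈ U := hadd.eventually (hU.mem_nhds hpv)
  have h3 : Tendsto (fun x => inner ℝ w (f (x + v) - f x)) (𝓝 p)
      (𝓝 (inner ℝ w (f (p + v) - f p))) :=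
    tendsto_const_nhds.inner
      (((hcont.continuousAt (hU.mem_nhds hpv)).tendsto.comp hadd).sub
        (hcont.continuousAt (hU.mem_nhds hp)).tendsto)
  obtain ⟨x, hx, ⟨hx1, hx2⟩, hx3⟩ := (Measure.dense_of_ae hline).inter_nhds_nonempty
    ((h1.and h2).and (h3.eventually_lt_const hlt))
  exact absurd (hgood x hx1 hx2 hx) (not_le.2 hx3)

/-- A compact convex set of injective linear maps is uniformly injective, and for each vector `v`
the values at `v` lie uniformly on one side of a hyperplane. -/
theorem exists_pos_forall_exists_le_inner {G : Type*} [NormedAddCommGroup G]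
    [InnerProductSpace ℝ G] [FiniteDimensional ℝ G] {T : Set (F →L[ℝ] G)} (hT : IsCompact T)
    (hc : Convex ℝ T) (hinj : ∀ A ∈ T, ∀ v, A v = 0 → v = 0) :
    ∃ c > 0, ∀ v, ∃ w : G, ‖w‖ ≤ 1 ∧ ∀ A ∈ T, c * ‖v‖ ≤ inner ℝ w (A v) := by
  obtain ⟨c, hc0, hcb⟩ := (hT.prod (isCompact_sphere (0 : F) 1)).exists_forall_le'
    (f := fun q : (F →L[ℝ] G) × F => ‖q.1 q.2‖) (a := 0) (by fun_prop) (by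
      rintro ⟨A, v⟩ ⟨hA, hv⟩
      refine norm_pos_iff.2 fun h => ?_
      have := hinj A hA v h
      simp [this] at hv)
  have hbound : ∀ A ∈ T, ∀ v, c * ‖v‖ ≤ ‖A v‖ := by
    intro A hA v
    rcases eq_or_ne v 0 with rfl | hv
    · simp
    · have := hcb (A, ‖v‖⁻¹ • v) ⟨hA, by simp [norm_smul, hv]⟩
      simp only [map_smul, norm_smul, norm_inv, norm_norm] at this
      rwa [inv_mul_eq_div, le_div_iff₀ (norm_pos_iff.2 hv)] at this
  refine ⟨c, hc0, fun v => ?_⟩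
  rcases eq_or_ne v 0 with rfl | hv
  · exact ⟨0, by simp⟩
  rcases T.eq_empty_or_nonempty with rfl | hne
  · exact ⟨0, by simp⟩
  let S : Set G := ContinuousLinearMap.apply ℝ G v '' T
  have hS : Convex ℝ S := hc.linear_image (ContinuousLinearMap.apply ℝ G v).toLinearMap
  have hSc : IsCompact S := hT.image (ContinuousLinearMap.apply ℝ G v).continuous
  -- For the point `q` of `S` nearest to the origin, the variational inequality reads `⟪q, A v⟫ ≥
  -- ‖q‖ ^ 2`; hence `w = q / ‖q‖`.
  obtain ⟨q, hq, hmin⟩ := exists_norm_eq_iInf_of_complete_convex (hne.image _)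
    hSc.isComplete hS 0
  rw [norm_eq_iInf_iff_real_inner_le_zero hS hq] at hmin
  have hqc : c * ‖v‖ ≤ ‖q‖ := by
    obtain ⟨A, hA, rfl⟩ := hq
    exact hbound A hA v
  have hq0 : 0 < ‖q‖ := lt_of_lt_of_le (by positivity) hqc
  refine ⟨‖q‖⁻¹ • q, by simp [norm_smul, hq0.ne'], fun A hA => hqc.trans ?_⟩
  have := hmin (A v) ⟨A, hA, rfl⟩
  rw [zero_sub, inner_neg_left, inner_sub_right, real_inner_self_eq_norm_sq] at this
  rw [real_inner_smul_left, inv_mul_eq_div, le_div_iff₀ hq0]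
  nlinarith

/-- If every element of the Clarke differential is injective on `{0} × F`, then `f` expands
distances in `F` near `p`, and every functional `inner u` of `f` grows in some direction of `F`. -/
theorem exists_bounds_of_clarkeDifferential {f : E × F → F} {p : E × F}
    (hf : IsLipschitzGermAt f p)
    (hinj : ∀ ℓ ∈ clarkeDifferential f p, ∀ v : F, ℓ (0, v) = 0 → v = 0) :
    ∃ K : ℝ≥0, ∃ c > 0, ∃ r > 0, LipschitzOnWith K f (ball p r) ∧
      (∀ x y y', (x, y) ∈ ball p r → (x, y') ∈ ball p r →
        c * ‖y' - y‖ ≤ ‖f (x, y') - f (x, y)‖) ∧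
      ∀ u : F, ∃ v : F, ∀ x y, ∀ t ≥ (0 : ℝ), (x, y) ∈ ball p r → (x, y + t • v) ∈ ball p r →
        t * (c * ‖u‖) ≤ inner ℝ u (f (x, y + t • v) - f (x, y)) := by
  obtain ⟨K, s, hs, hK⟩ := hf
  let R : ((E × F) →L[ℝ] F) →L[ℝ] (F →L[ℝ] F) :=
    (ContinuousLinearMap.compL ℝ F (E × F) F).flip (ContinuousLinearMap.inr ℝ E F)
  have hR : ∀ ℓ v, R ℓ v = ℓ (0, v) := fun ℓ v => rfl
  let T := R '' clarkeDifferential f p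
  have hT : IsCompact T := (hK.isCompact_clarkeDifferential hs).image R.continuous
  have hTc : Convex ℝ T := (convex_convexHull ℝ _).linear_image R.toLinearMap
  have hTi : ∀ A ∈ T, ∀ v, A v = 0 → v = 0 := by
    rintro _ ⟨ℓ, hℓ, rfl⟩ v hv
    exact hinj ℓ hℓ v hv
  let adj : (F →L[ℝ] F) →ₗ[ℝ] (F →L[ℝ] F) :=
    { toFun := fun A => ContinuousLinearMap.adjoint A
      map_add' := fun A B => map_add _ A B
      map_smul' := fun a A => by simp }
  have hadj : ∀ A, adj A = ContinuousLinearMap.adjoint A := fun A => rfl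
  obtain ⟨c₁, hc₁, h₁⟩ := exists_pos_forall_exists_le_inner hT hTc hTi
  obtain ⟨c₂, hc₂, h₂⟩ := exists_pos_forall_exists_le_inner (hT.image adj.continuous_of_finiteDimensional)
    (hTc.linear_image adj) (by
      rintro _ ⟨A, hA, rfl⟩ u hu
      have hsurj : Function.Surjective A := by
        have : Function.Injective A.toLinearMap := by
          rw [← LinearMap.ker_eq_bot, LinearMap.ker_eq_bot']
          exact hTi A hA
        exact LinearMap.injective_iff_surjective.1 this
      obtain ⟨v, rfl⟩ := hsurj u
      rw [← inner_self_eq_zero (𝕜 := ℝ), ← ContinuousLinearMap.adjoint_inner_right]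
      have hu' : ContinuousLinearMap.adjoint A (A v) = 0 := hu
      rw [hu', inner_zero_right])
  set c := min c₁ c₂ with hc
  have hc0 : 0 < c := lt_min hc₁ hc₂
  obtain ⟨r, hr, hball⟩ := Metric.eventually_nhds_iff_ball.1
    ((hK.eventually_exists_limitingDifferentials_norm_sub_lt hs (half_pos hc0)).and hs)
  have hKU : LipschitzOnWith K f (ball p r) := hK.mono fun x hx => (hball x hx).2
  -- The slack `c / 2 * (‖w‖ * ‖v‖)` absorbs the distance from a nearby differential to a limiting
  -- one.
  have key : ∀ (w v : F) (a : ℝ), (∀ A ∈ T, a + c / 2 * (‖w‖ * ‖v‖) ≤ inner ℝ w (A v)) →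
      ∀ x y, ∀ t ≥ (0 : ℝ), (x, y) ∈ ball p r → (x, y + t • v) ∈ ball p r →
      t * a ≤ inner ℝ w (f (x, y + t • v) - f (x, y)) := by
    intro w v a hA x y t ht hxy hxy'
    have heq : (x, y + t • v) = (x, y) + ((0, t • v) : E × F) := by simp
    rw [heq] at hxy' ⊢
    refine hKU.le_inner_sub_of_forall_le_fderiv isOpen_ball (convex_ball p r) ?_ hxy hxy'
    intro q hq hdq
    obtain ⟨B, hB, hBn⟩ := (hball q hq).1 hdq
    have hBA := hA (R B) ⟨B, subset_convexHull ℝ _ hB, rfl⟩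
    rw [hR] at hBA
    have hsm : ((0, t • v) : E × F) = t • (0, v) := by simp
    rw [hsm, map_smul, inner_smul_right]
    refine mul_le_mul_of_nonneg_left ?_ ht
    have hdiff : |inner ℝ w ((fderiv ℝ f q - B) (0, v))| ≤ c / 2 * (‖w‖ * ‖v‖) := by
      refine (abs_real_inner_le_norm _ _).trans ?_
      have h0 : ‖((0, v) : E × F)‖ = ‖v‖ := by simp [Prod.norm_def]
      have := (fderiv ℝ f q - B).le_of_opNorm_le hBn.le (0, v)
      rw [h0] at this
      calc ‖w‖ * ‖(fderiv ℝ f q - B) (0, v)‖ ≤ ‖w‖ * (c / 2 * ‖v‖) := by gcongr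
        _ = _ := by ring
    have h3 := (abs_le.1 hdiff).1
    rw [sub_apply, inner_sub_right] at h3
    linarith
  refine ⟨K, c / 2, half_pos hc0, r, hr, hKU, ?_, ?_⟩
  · intro x y y' hy hy'
    obtain ⟨w, hw, hwA⟩ := h₁ (y' - y)
    have := key w (y' - y) (c / 2 * ‖y' - y‖) (fun A hA => by
      refine le_trans ?_ (hwA A hA)
      have h1 : c * ‖y' - y‖ ≤ c₁ * ‖y' - y‖ := by gcongr; exact min_le_left _ _
      have h2 : c / 2 * (‖w‖ * ‖y' - y‖) ≤ c / 2 * (1 * ‖y' - y‖) := by gcongr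
      linarith) x y 1 zero_le_one hy (by simpa using hy')
    rw [one_smul, add_sub_cancel, one_mul] at this
    refine this.trans ((real_inner_le_norm _ _).trans ?_)
    exact mul_le_of_le_one_left (norm_nonneg _) hw
  · intro u
    obtain ⟨v, hv, hvA⟩ := h₂ u
    refine ⟨v, key u v (c / 2 * ‖u‖) fun A hA => ?_⟩
    have := hvA _ ⟨A, hA, rfl⟩
    rw [hadj, ContinuousLinearMap.adjoint_inner_right, real_inner_comm] at this
    refine le_trans ?_ this
    have h1 : c * ‖u‖ ≤ c₂ * ‖u‖ := by gcongr; exact min_le_right _ _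
    have h2 : c / 2 * (‖u‖ * ‖v‖) ≤ c / 2 * (‖u‖ * 1) := by gcongr
    linarith

/-! ### The straightening homeomorphism -/

/-- Clarke's inverse function theorem for the map `(x, y) ↦ (x - p.1, f (x, y))`. -/
theorem exists_bilipschitz_straightening {f : E × F → F} {p : E × F}
    (hf : IsLipschitzGermAt f p)
    (hinj : ∀ ℓ ∈ clarkeDifferential f p, ∀ v : F, ℓ (0, v) = 0 → v = 0) :
    ∃ φ : OpenPartialHomeomorph (E × F) (E × F), IsBilipschitzHomeomorph φ ∧ p ∈ φ.source ∧
      ∀ q, φ q = (q.1 - p.1, f q) := by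
  obtain ⟨K, c, hc, r, hr, hK, hbound, hdir⟩ := exists_bounds_of_clarkeDifferential hf hinj
  set U := ball p r with hUdef
  have hU : IsOpen U := isOpen_ball
  have hpU : p ∈ U := mem_ball_self hr
  let Φ : E × F → E × F := fun q => (q.1 - p.1, f q)
  have hopen : IsOpen (Φ '' U) := isOpen_image_prodMk_sub hc hU hK p.1 hbound hdir
  have hΦ : LipschitzOnWith (max 1 K) Φ U := by
    refine LipschitzOnWith.of_dist_le_mul fun q hq q' hq' => ?_
    rw [Prod.dist_eq, max_le_iff]
    refine ⟨?_, ?_⟩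
    · rw [dist_sub_right]
      refine (le_max_left _ _ : _ ≤ dist q q').trans
        (le_mul_of_one_le_left (dist_nonneg (x := q) (y := q')) ?_)
      exact_mod_cast le_max_left _ _
    · refine (hK.dist_le_mul _ hq _ hq').trans ?_
      gcongr
      exact le_max_right _ _
  -- With `D` the distance of the images, comparison through the mixed point `(x, y')` gives `c *
  -- dist y y' ≤ D + K * D`; the 1 handles the first coordinate.
  let C : ℝ≥0 := max 1 (⟨c, hc.le⟩⁻¹ * (1 + K))
  have hanti : ∀ q ∈ U, ∀ q' ∈ U, dist q q' ≤ C * dist (Φ q) (Φ q') := by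
    rintro ⟨x, y⟩ hq ⟨x', y'⟩ hq'
    have hmix : (x, y') ∈ U := by
      rw [hUdef, ← ball_prod_same] at hq hq' ⊢
      exact ⟨hq.1, hq'.2⟩
    set D := dist (Φ (x, y)) (Φ (x', y')) with hD
    have hD0 : 0 ≤ D := dist_nonneg
    have h1 : dist x x' ≤ D := by
      exact le_trans (dist_sub_right x x' p.1).ge (le_max_left _ _)
    have h2 : dist (f (x, y)) (f (x', y')) ≤ D := le_max_right _ _
    have h3 : c * dist y y' ≤ dist (f (x, y)) (f (x, y')) := by
      rw [dist_eq_norm, dist_eq_norm]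
      exact hbound x y' y hmix hq
    have h4 : dist (f (x, y')) (f (x', y')) ≤ K * dist x x' := by
      refine (hK.dist_le_mul _ hmix _ hq').trans_eq ?_
      simp [Prod.dist_eq]
    have h5 := dist_triangle_right (f (x, y)) (f (x, y')) (f (x', y'))
    have h6 : (K : ℝ) * dist x x' ≤ K * D := by gcongr
    rw [Prod.dist_eq, max_le_iff]
    constructor
    · refine h1.trans (le_mul_of_one_le_left hD0 ?_)
      exact_mod_cast le_max_left _ _
    · have h7 : dist y y' ≤ c⁻¹ * (1 + K) * D := by
        rw [mul_assoc, inv_mul_eq_div, le_div_iff₀ hc]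
        linarith
      exact h7.trans (mul_le_mul_of_nonneg_right (le_max_right (1 : ℝ) (c⁻¹ * (1 + K))) hD0)
  have hinjOn : InjOn Φ U := fun q hq q' hq' h => by
    have := hanti q hq q' hq'
    rw [h, dist_self, mul_zero] at this
    exact dist_le_zero.1 this
  let e : PartialEquiv (E × F) (E × F) := hinjOn.toPartialEquiv Φ U
  have hsymm : LipschitzOnWith C e.symm (Φ '' U) := by
    refine LipschitzOnWith.of_dist_le_mul fun a ha b hb => ?_
    have ha' : a ∈ e.target := ha
    have hb' : b ∈ e.target := hb
    have := hanti _ (e.map_target ha') _ (e.map_target hb')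
    have h1 : Φ (e.symm a) = a := e.right_inv ha'
    have h2 : Φ (e.symm b) = b := e.right_inv hb'
    rwa [h1, h2] at this
  exact ⟨{ toPartialEquiv := e
           continuousOn_toFun := hΦ.continuousOn
           continuousOn_invFun := hsymm.continuousOn
           open_source := hU
           open_target := hopen }, ⟨⟨_, hΦ⟩, ⟨_, hsymm⟩⟩, hpU, fun q => rfl⟩

end ClarkeInverse

theorem corollary2p3 (m k : ℕ)
    (f : EuclideanSpace ℝ (Fin m) × EuclideanSpace ℝ (Fin k) → EuclideanSpace ℝ (Fin k))
    (x₀ : EuclideanSpace ℝ (Fin m)) (y₀ z₀ : EuclideanSpace ℝ (Fin k))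
    (hf : IsLipschitzGermAt f (x₀, y₀)) (hz : f (x₀, y₀) = z₀)
    (hker : ∀ ℓ ∈ clarkeDifferential f (x₀, y₀),
      LinearMap.ker (ℓ : EuclideanSpace ℝ (Fin m) × EuclideanSpace ℝ (Fin k) →ₗ[ℝ]
        EuclideanSpace ℝ (Fin k)) ⊓ Submodule.prod ⊥ ⊤ = ⊥) :
    ∃ φ : OpenPartialHomeomorph (EuclideanSpace ℝ (Fin m) × EuclideanSpace ℝ (Fin k))
        (EuclideanSpace ℝ (Fin m) × EuclideanSpace ℝ (Fin k)),
      IsBilipschitzHomeomorph φ ∧ (x₀, y₀) ∈ φ.source ∧ φ (x₀, y₀) = (0, z₀) ∧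
      ∀ p ∈ φ.source, f p = (φ p).2 := by
  obtain ⟨φ, hφ, hp, hφq⟩ := exists_bilipschitz_straightening hf fun ℓ hℓ v hv => by
    have hmem : ((0, v) : EuclideanSpace ℝ (Fin m) × EuclideanSpace ℝ (Fin k)) ∈
        LinearMap.ker (ℓ : EuclideanSpace ℝ (Fin m) × EuclideanSpace ℝ (Fin k) →ₗ[ℝ]
          EuclideanSpace ℝ (Fin k)) ⊓ Submodule.prod ⊥ ⊤ :=
      ⟨hv, Submodule.mem_prod.2 ⟨Submodule.zero_mem _, Submodule.mem_top⟩⟩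
    rw [hker ℓ hℓ, Submodule.mem_bot] at hmem
    exact congrArg Prod.snd hmem
  exact ⟨φ, hφ, hp, by simp [hφq, hz], fun q _ => by rw [hφq]⟩
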